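/- **Setting.** Let $c,G,m>0$, let $\lambda<0$ be the cosmological constant, $a=\sqrt{|\lambda|/3}$ and $\rho_{\mathrm{vac}}=\lambda c^4/(8\pi G)$. In the global Fermi coordinates $(t,\mathbf x)\in\mathbb R\times\mathbb R^3$ of a geodesic observer, with $\rho=|\mathbf x|$ and the angular coordinates $\theta,\phi$ of $\mathbf x$, (the covering space of) anti-de Sitter space has the metric $$ds^2=-c^2\cosh^2(a\rho)\,dt^2+d\rho^2+\frac{\sinh^2(a\rho)}{a^2}\left(d\theta^2+\sin^2\theta\,d\phi^2\right).$$ The Fermi surface $X=\{t=0\}\cong\mathbb R^3$ carries the induced metric ${}^3g$ (hyperbolic space), with proper distance $d$ and Riemannian volume $|\Lambda|$; $d\mathbf x$ is Lebesgue measure in the Fermi chart. $K=\partial/\partial t$ is the timelike Killing field, and for $\beta>0$ put $\gamma(\mathbf x)=\|K\|\beta mc=\beta mc^2\cosh(a\rho)$. Let $\Gamma_X$ be the set of all $x\subset X$ with $|x\cap C|<\infty$ for every compact $C$, and let $\mathcal B_c(X)$ be the set of Borel sets with compact closure. Let $\mathcal B(\Gamma_X)$ be the $\sigma$-algebra generated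 by the functions $x\mapsto|x\cap\Lambda|$, $\Lambda\in\mathcal B_c(X)$. For $z\ge 0$ let $\nu_\Lambda=\sum_{n\ge0}\frac{z^n}{n!}\,d\mathbf x^n$, where $d\mathbf x^n$ is the image of Lebesgue measure on the $n$-tuples of distinct points of $\Lambda$ under $(x_1,\dots,x_n)\mapsto\{x_1,\dots,x_n\}$. An interaction is given by measurable functions $\phi_n$, $n\ge2$, from the $n$-point subsets of $X$ to $\mathbb R\cup\{+\infty\}$ that are bounded below uniformly in $n$. The one-body potential is determined by $e^{-\beta\phi_1(\mathbf x)}=K_2(\gamma(\mathbf x))/\gamma(\mathbf x)$, where $K_2$ is the modified Bessel function of the second kind. For $\Lambda\in\mathcal B_c(X)$, $s\in\Gamma_X$ and finite $x\subset\Lambda$ put $$V_\Lambda(x|s)=|\Lambda|\rho_{\mathrm{vac}}+\sum_{n\ge1}\ \sum_{\substack{y\subset x\cup(s\setminus\Lambda)\\ y\cap x\ne\varnothing,\ |y|=n}}\phi_n(y),\qquad \tilde V_\Lambda(x|s)=\sum_{n\ge2}\ \sum_{\substack{y\subset x\cup(s\setminus\Lambda)\\ y\cap x\ne\varnothing,\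 |y|=n}}\phi_n(y),$$ each read as $+\infty$ if it does not converge absolutely. Let $$Z_\Lambda(s)=\int e^{-\beta V_\Lambda(x|s)}\,\nu_\Lambda(dx),\qquad \Pi_\Lambda(A,s)=\frac{\mathbf 1_{Z_\Lambda(s)<\infty}}{Z_\Lambda(s)}\int \mathbf 1_A\big(x\cup(s\setminus\Lambda)\big)\,e^{-\beta V_\Lambda(x|s)}\,\nu_\Lambda(dx).$$ A Gibbs state for $V,\beta,z$ is a probability measure $\mu$ on $(\Gamma_X,\mathcal B(\Gamma_X))$ such that $\int\Pi_\Lambda(A,s)\,\mu(ds)=\mu(A)$ for all $A\in\mathcal B(\Gamma_X)$ and all $\Lambda\in\mathcal B_c(X)$. **Theorem.** Assume that the interaction has finite range, i.e. for each $n\ge2$ there is $R>0$ such that $\phi_n(\{x_1,\dots,x_n\})=0$ whenever $d(x_i,x_j)>R$ for some $i,j$. Assume further that for some constant $B>0$ $$\tilde V_\Lambda(\{x_1,\dots,x_n\}|s)>-Bn$$ for all $\Lambda\in\mathcal B_c(X)$, all $s\in\Gamma_X$, all $n\ge1$ and all sets $\{x_1,\dots,x_n\}\subset\Lambda$ of $n$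 distinct points. Then for every $\beta>0$ and every $z\ge0$ there is at most one Gibbs state on $(\Gamma_X,\mathcal B(\Gamma_X))$ for $V,\beta,z$. -/

import Mathlib

open MeasureTheory Set
open scoped ENNReal

noncomputable section

namespace AdS

/-! ### Anti-de Sitter space in Fermi coordinates -/

/-- The Fermi surface `t = 0` of the geodesic observer, in the global chart given by the Cartesian
Fermi coordinates `x = (x¹, x², x³)`. The norm of this type is the coordinate
`ρ = √((x¹)² + (x²)² + (x³)²)`, and its `volume` is the Lebesgue measure `dx = dx¹ dx² dx³`. The
hyperbolic geometry of the surface is given by `spatialMetric` below. -/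
abbrev Space : Type := EuclideanSpace ℝ (Fin 3)

/-- The constant `a = √(|Λ| / 3)` for the cosmological constant `Λ = lam`. -/
def curv (lam : ℝ) : ℝ := Real.sqrt (|lam| / 3)

/-- The smooth function `sinh (a r) / (a r)`, equal to `1` at `r = 0`. -/
def sinhRatio (a r : ℝ) : ℝ := if r = 0 then 1 else Real.sinh (a * r) / (a * r)

/-- The radial component `dρ(v)` of the tangent vector `v` at `x` (and `0` at the origin). -/
def radial (x v : Space) : ℝ := inner ℝ x v / ‖x‖

/-- The metric of (the covering space of) anti-de Sitter space in the global Fermi coordinates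
`p = (t, x)`,
`ds² = - c² cosh² (a ρ) dt² + dρ² + (sinh² (a ρ) / a²) (dθ² + sin² θ dφ²)`,
where `ρ² (dθ² + sin² θ dφ²) = |dx|² - dρ²`. -/
def metric (c lam : ℝ) (p v w : ℝ × Space) : ℝ :=
  -(c ^ 2 * Real.cosh (curv lam * ‖p.2‖) ^ 2 * v.1 * w.1)
    + radial p.2 v.2 * radial p.2 w.2
    + sinhRatio (curv lam) ‖p.2‖ ^ 2 *
        (inner ℝ v.2 w.2 - radial p.2 v.2 * radial p.2 w.2)

/-- The timelike Killing field `K = ∂/∂t`. -/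
def killing : ℝ × Space := (1, 0)

/-- The norm `‖K‖ = √(-g(K, K))` on the Fermi surface. -/
def killingNorm (c lam : ℝ) (x : Space) : ℝ :=
  Real.sqrt (-(metric c lam (0, x) killing killing))

/-- The Riemannian metric induced on the Fermi surface `t = 0`. -/
def spatialMetric (c lam : ℝ) (x v w : Space) : ℝ :=
  metric c lam (0, x) (0, v) (0, w)

/-- The proper length of a `C¹` curve `[0, 1] → Space`. -/
def curveLength (c lam : ℝ) (u : ℝ → Space) : ℝ :=
  ∫ t in (0 : ℝ)..1, Real.sqrt (spatialMetric c lam (u t) (deriv u t) (deriv u t))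

/-- The proper (Riemannian) distance on the Fermi surface: the infimum of the lengths of the `C¹`
curves from `x` to `y`. -/
def properDist (c lam : ℝ) (x y : Space) : ℝ :=
  sInf {L : ℝ | ∃ u : ℝ → Space, ContDiff ℝ 1 u ∧ u 0 = x ∧ u 1 = y ∧ L = curveLength c lam u}

/-- The Riemannian volume measure `√(det ³g) dx` on the Fermi surface. -/
def properVolume (c lam : ℝ) : Measure Space :=
  volume.withDensity fun x => ENNReal.ofReal (Real.sqrt (Matrix.det
    (Matrix.of fun i j : Fin 3 => spatialMetric c lam x
      (EuclideanSpace.single i 1) (EuclideanSpace.single j 1))))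

/-- The energy density of the vacuum, `ρ_vac = Λ c⁴ / (8 π G)`. -/
def vacuumDensity (c G lam : ℝ) : ℝ := lam * c ^ 4 / (8 * Real.pi * G)

/-! ### Configurations -/

/-- Locally finite configurations: subsets of `Space` that meet every compact set in a finite
set. -/
def Config : Type := {x : Set Space // ∀ K : Set Space, IsCompact K → (x ∩ K).Finite}

namespace Config

/-- The number `N_Λ(x)` of points of the configuration `x` in `Λ` (finite if `Λ` has compact
closure). -/
def count (Λ : Set Space) (x : Config) : ℕ := (x.1 ∩ Λ).ncard

end Config

/-- The Borel sets with compact closure. -/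
def BorelRelCompact (Λ : Set Space) : Prop := MeasurableSet Λ ∧ IsCompact (closure Λ)

/-- The `σ`-algebra on configurations generated by all the counting functions `N_Λ`, where `Λ` is a
Borel set with compact closure. -/
instance Config.instMeasurableSpace : MeasurableSpace Config :=
  ⨆ (Λ : Set Space) (_ : BorelRelCompact Λ), MeasurableSpace.comap (Config.count Λ) ⊤

/-- The configuration `{x₁, …, xₙ}`. -/
def Config.ofTuple {n : ℕ} (x : Fin n → Space) : Config :=
  ⟨range x, fun _ _ => (finite_range x).inter_of_left _⟩

/-- The configuration `x ∪ (s ∩ Λᶜ)`. -/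
def Config.glue (Λ : Set Space) (x s : Config) : Config :=
  ⟨x.1 ∪ (s.1 \ Λ), fun K hK => by
    rw [union_inter_distrib_right]
    exact (x.2 K hK).union ((s.2 K hK).subset fun _ h => ⟨h.1.1, h.2⟩)⟩

/-- The map `(x₁, …, xₙ) ↦ {x₁, …, xₙ}` is measurable, so that its image measures make sense. -/
theorem Config.measurable_ofTuple (n : ℕ) :
    Measurable (Config.ofTuple : (Fin n → Space) → Config) := by
  classical
  refine Measurable.of_comap_le ?_
  simp only [Config.instMeasurableSpace, MeasurableSpace.comap_iSup, MeasurableSpace.comap_comp,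
    iSup_le_iff]
  intro Λ hΛ
  rw [← measurable_iff_comap_le]
  have key : (Config.count Λ ∘ Config.ofTuple : (Fin n → Space) → ℕ) =
      fun x => ∑ i : Fin n, if x i ∈ Λ ∧ ∀ j : Fin n, j < i → x j ≠ x i then 1 else 0 := by
    funext x
    rw [← Finset.card_filter]
    simp only [Function.comp, Config.count, Config.ofTuple]
    rw [← Set.ncard_coe_finset]
    symm
    refine Set.ncard_congr (fun i _ => x i) ?_ ?_ ?_
    · intro i hi
      simp only [Finset.coe_filter, Finset.mem_univ, true_and, mem_ofPred_eq] at hi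
      exact ⟨mem_range_self i, hi.1⟩
    · intro i j hi hj hij
      simp only [Finset.coe_filter, Finset.mem_univ, true_and, mem_ofPred_eq] at hi hj
      rcases lt_trichotomy i j with h | h | h
      · exact absurd hij (hj.2 i h)
      · exact h
      · exact absurd hij.symm (hi.2 j h)
    · rintro _ ⟨⟨i, rfl⟩, hi⟩
      have hne : (Finset.univ.filter fun j => x j = x i).Nonempty := ⟨i, by simp⟩
      obtain ⟨h1, h2⟩ : x ((Finset.univ.filter fun j => x j = x i).min' hne) = x i ∧ True :=
        ⟨(Finset.mem_filter.1 (Finset.min'_mem _ hne)).2, trivial⟩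
      refine ⟨(Finset.univ.filter fun j => x j = x i).min' hne, ?_, h1⟩
      simp only [Finset.coe_filter, Finset.mem_univ, true_and, mem_ofPred_eq]
      refine ⟨by rw [h1]; exact hi, fun j hj hji => ?_⟩
      exact absurd (Finset.min'_le _ j (by simp [hji, h1])) (not_le.2 hj)
  rw [key]
  refine Finset.measurable_sum _ fun i _ => Measurable.ite ?_ measurable_const measurable_const
  have h : MeasurableSet ((fun x : Fin n → Space => x i) ⁻¹' Λ ∩
      ⋂ (j : Fin n) (_ : j < i), {x : Fin n → Space | x j = x i}ᶜ) :=
    (measurable_pi_apply i hΛ.1).inter (MeasurableSet.iInter fun j => MeasurableSet.iInter fun _ =>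
      (measurableSet_eq_fun (measurable_pi_apply j) (measurable_pi_apply i)).compl)
  convert h using 1
  ext x
  simp

/-- The unnormalized Poisson measure `ν_Λ = ∑ₙ (zⁿ / n!) dxⁿ` on the finite configurations in `Λ`;
here `dxⁿ` is the image of the Lebesgue measure on the `n`-tuples of distinct points of `Λ`. -/
def poisson (z : ℝ) (Λ : Set Space) : Measure Config :=
  Measure.sum fun n : ℕ => ENNReal.ofReal (z ^ n / n.factorial) •
    Measure.map Config.ofTuple
      ((volume : Measure (Fin n → Space)).restrict
        {x | (∀ i, x i ∈ Λ) ∧ Function.Injective x})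

/-! ### Interactions -/

/-- The modified Bessel function of the second kind `K_ν(r)`, for `r > 0`. -/
def besselK (ν r : ℝ) : ℝ :=
  ∫ t in Ioi (0 : ℝ), Real.exp (-(r * Real.cosh t)) * Real.cosh (ν * t)

/-- `γ(x) = ‖K‖ β m c`. -/
def gam (c lam m β : ℝ) (x : Space) : ℝ := killingNorm c lam x * β * m * c

/-- The one-body potential `φ₁`, determined by `exp (-β φ₁(x)) = K₂(γ(x)) / γ(x)`. -/
def oneBody (c lam m β : ℝ) (x : Space) : ℝ :=
  -(1 / β) * Real.log (besselK 2 (gam c lam m β x) / gam c lam m β x)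

/-- The many-body potentials `φₙ : {n-point configurations} → ℝ ∪ {+∞}`, `n ≥ 2`: measurable and
bounded below, uniformly in `n`. The values of `φ` at sets with at most one point are never used. -/
structure ManyBodyPotential where
  /-- `φₙ(y)`, for `n = |y|` -/
  φ : Finset Space → EReal
  measurable : ∀ n : ℕ, 2 ≤ n →
    Measurable fun x : {x : Fin n → Space // Function.Injective x} =>
      φ (Finset.univ.map ⟨x.1, x.2⟩)
  bddBelow : ∃ b : ℝ, ∀ y : Finset Space, 2 ≤ y.card → (b : EReal) ≤ φ y

/-- The sum over `y ∈ I` of the numbers `f y ∈ ℝ ∪ {+∞}` if it converges absolutely, and `+∞`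
otherwise. (For real families, `Summable` is absolute convergence.) -/
def sumOrTop (I : Set (Finset Space)) (f : Finset Space → EReal) : EReal :=
  open Classical in
  if (∀ y ∈ I, f y ≠ ⊤) ∧ Summable (fun y : I => (f y).toReal) then
    ((∑' y : I, (f y).toReal : ℝ) : EReal)
  else ⊤

/-- The finite sets `y ⊆ x ∪ (s ∩ Λᶜ)` with `y ∩ x ≠ ∅`. -/
def clusters (Λ x s : Set Space) : Set (Finset Space) :=
  {y | (y : Set Space) ⊆ x ∪ (s \ Λ) ∧ ((y : Set Space) ∩ x).Nonempty}

namespace ManyBodyPotential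

/-- Finite range: for each `n ≥ 2` there is `R > 0` such that `φₙ(x₁, …, xₙ) = 0` whenever the
proper distance of some `xᵢ` and `xⱼ` exceeds `R`. -/
def HasFiniteRange (Φ : ManyBodyPotential) (c lam : ℝ) : Prop :=
  ∀ n : ℕ, 2 ≤ n → ∃ R : ℝ, 0 < R ∧ ∀ y : Finset Space, y.card = n →
    (∃ p ∈ y, ∃ q ∈ y, R < properDist c lam p q) → Φ.φ y = 0

/-- The many-body part `Ṽ_Λ(x|s)` of the energy of `x` in `Λ` with boundary condition `s`. -/
def manyBodyEnergy (Φ : ManyBodyPotential) (Λ x s : Set Space) : EReal :=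
  sumOrTop {y ∈ clusters Λ x s | 2 ≤ y.card} Φ.φ

/-- The lower bound `Ṽ_Λ(x₁, …, xₙ|s) > -B n` for a constant `B > 0`, all `Λ`, all boundary
configurations `s` and all configurations of `n ≥ 1` points in `Λ`. -/
def IsStable (Φ : ManyBodyPotential) : Prop :=
  ∃ B : ℝ, 0 < B ∧ ∀ Λ : Set Space, BorelRelCompact Λ → ∀ (s : Config) (x : Finset Space),
    (x : Set Space) ⊆ Λ → x.Nonempty →
      ((-(B * x.card) : ℝ) : EReal) < Φ.manyBodyEnergy Λ x s.1

/-- The potential `φₙ(y)`, `n = |y| ≥ 1`, including the one-body potential. -/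
def full (Φ : ManyBodyPotential) (c lam m β : ℝ) (y : Finset Space) : EReal :=
  if y.card = 1 then ((∑ p ∈ y, oneBody c lam m β p : ℝ) : EReal) else Φ.φ y

/-- The energy `V_Λ(x|s) = |Λ| ρ_vac + ∑ φₙ(y)`, where the sum extends over all finite
`y ⊆ x ∪ (s ∩ Λᶜ)` that meet `x`. -/
def energy (Φ : ManyBodyPotential) (c G lam m β : ℝ) (Λ x s : Set Space) : EReal :=
  (((properVolume c lam Λ).toReal * vacuumDensity c G lam : ℝ) : EReal)
    + sumOrTop (clusters Λ x s) (Φ.full c lam m β)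

/-- The Boltzmann factor `exp (-β V_Λ(x|s))`, where `exp (-∞) = 0`. -/
def boltzmann (Φ : ManyBodyPotential) (c G lam m β : ℝ) (Λ : Set Space) (x s : Config) : ℝ≥0∞ :=
  EReal.exp (-((β : EReal) * Φ.energy c G lam m β Λ x.1 s.1))

/-- The partition function `Z_Λ(s)`. -/
def partition (Φ : ManyBodyPotential) (c G lam m β z : ℝ) (Λ : Set Space) (s : Config) : ℝ≥0∞ :=
  ∫⁻ x, Φ.boltzmann c G lam m β Λ x s ∂poisson z Λ

/-- The local specification `Π_Λ(A, s)`. -/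
def specification (Φ : ManyBodyPotential) (c G lam m β z : ℝ) (Λ : Set Space) (A : Set Config)
    (s : Config) : ℝ≥0∞ :=
  open Classical in
  if Φ.partition c G lam m β z Λ s < ⊤ then
    (Φ.partition c G lam m β z Λ s)⁻¹ *
      ∫⁻ x, A.indicator 1 (Config.glue Λ x s) * Φ.boltzmann c G lam m β Λ x s ∂poisson z Λ
  else 0

/-- Gibbs states: the probability measures on configurations that satisfy the DLR equations. -/
structure IsGibbsState (Φ : ManyBodyPotential) (c G lam m β z : ℝ) (μ : Measure Config) :
    Prop where
  prob : IsProbabilityMeasure μ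
  dlr : ∀ Λ : Set Space, BorelRelCompact Λ → ∀ A : Set Config, MeasurableSet A →
    ∫⁻ s, Φ.specification c G lam m β z Λ A s ∂μ = μ A

end ManyBodyPotential

end AdS

end

open Filter Topology

namespace AdS

/-! ### The Bessel function and the one-body weight -/

/-! Gravity confines the gas. Since `γ` is a constant times `cosh (aρ)` and `K₂(γ)/γ` is at most a
constant times `γ⁻⁵`, the one-body weight is Lebesgue integrable over the whole Fermi surface
(`exists_integrable_oneBody_weight_le`). By stability every further particle costs at most a factor
`e^{βB}`, so the Boltzmann factor is dominated by a product of one-particle weights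
(`boltzmann_ofTuple_le`).

Keeping only the empty configuration bounds `Z_Λ` below by the vacuum weight, which also multiplies
the numerator and cancels. Hence `Λ` is occupied with probability at most `e^κ - 1`, uniformly in
the boundary condition, where `κ` is the activity of `Λ` (`specification_occupied_le`). Averaging
with the DLR equation and exhausting the space, any Gibbs state sees a particle outside a large ball
with small probability.

When nothing lies outside the ball, the local specification is the one with empty boundary
condition. Every Gibbs state is therefore close to `Π_Λ(·, ∅)` on each event
(`le_specification_empty_add`), with an error that tends to `0` as the ball grows; two Gibbs states
must agree. -/

theorem one_add_sq_le_cosh_sq (t : ℝ) : 1 + t ^ 2 ≤ Real.cosh t ^ 2 := by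
  have h : |t| ≤ |Real.sinh t| := by
    rw [Real.abs_sinh]
    exact Real.self_le_sinh_iff.2 (abs_nonneg t)
  rw [Real.cosh_sq', ← sq_abs t, ← sq_abs (Real.sinh t)]
  gcongr

/-- Uses `e^u ≥ u⁴/24` and `cosh 2t ≤ 2 cosh² t`. The fourth power leaves `cosh⁻² t`, enough to
integrate in `t`, and a factor `r⁻⁴`, enough for the decay in space. -/
theorem besselK_two_integrand_le {r : ℝ} (hr : 0 < r) (t : ℝ) :
    Real.exp (-(r * Real.cosh t)) * Real.cosh (2 * t) ≤ 48 / r ^ 4 * (1 + t ^ 2)⁻¹ := by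
  have hc : 0 < Real.cosh t := Real.cosh_pos t
  have h1 : (r * Real.cosh t) ^ 4 / 24 ≤ Real.exp (r * Real.cosh t) := by
    simpa [Nat.factorial] using Real.pow_div_factorial_le_exp _ (mul_pos hr hc).le 4
  have h2 : Real.cosh (2 * t) ≤ 2 * Real.cosh t ^ 2 := by
    rw [Real.cosh_two_mul, Real.cosh_sq]; linarith
  calc Real.exp (-(r * Real.cosh t)) * Real.cosh (2 * t)
      ≤ ((r * Real.cosh t) ^ 4 / 24)⁻¹ * (2 * Real.cosh t ^ 2) := by
        rw [Real.exp_neg]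
        gcongr
    _ = 48 / r ^ 4 * (Real.cosh t ^ 2)⁻¹ := by field_simp; norm_num
    _ ≤ 48 / r ^ 4 * (1 + t ^ 2)⁻¹ := by
        gcongr
        exact one_add_sq_le_cosh_sq t

theorem besselK_two_integrableOn {r : ℝ} (hr : 0 < r) :
    IntegrableOn (fun t => Real.exp (-(r * Real.cosh t)) * Real.cosh (2 * t)) (Ioi 0) := by
  refine Integrable.mono' ((integrable_inv_one_add_sq.const_mul (48 / r ^ 4)).integrableOn)
    (by fun_prop) (Eventually.of_forall fun t => ?_)
  rw [Real.norm_of_nonneg (mul_nonneg (Real.exp_pos _).le (Real.cosh_pos _).le)]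
  exact besselK_two_integrand_le hr t

theorem besselK_two_pos {r : ℝ} (hr : 0 < r) : 0 < besselK 2 r := by
  have hpos : ∀ t : ℝ, 0 < Real.exp (-(r * Real.cosh t)) * Real.cosh (2 * t) := fun t =>
    mul_pos (Real.exp_pos _) (Real.cosh_pos _)
  rw [besselK, setIntegral_pos_iff_support_of_nonneg_ae
    (Eventually.of_forall fun t => (hpos t).le) (besselK_two_integrableOn hr)]
  rw [show Function.support (fun t => Real.exp (-(r * Real.cosh t)) * Real.cosh (2 * t)) = univ
    from eq_univ_of_forall fun t => (hpos t).ne']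
  simp

theorem besselK_two_le {r : ℝ} (hr : 0 < r) :
    besselK 2 r ≤ 48 / r ^ 4 * ∫ t in Ioi (0 : ℝ), (1 + t ^ 2)⁻¹ := by
  rw [besselK, ← integral_const_mul]
  exact integral_mono (besselK_two_integrableOn hr)
    ((integrable_inv_one_add_sq.const_mul (48 / r ^ 4)).integrableOn)
    (besselK_two_integrand_le hr)

theorem curv_pos {lam : ℝ} (hlam : lam < 0) : 0 < curv lam :=
  Real.sqrt_pos.2 (div_pos (abs_pos.2 hlam.ne) (by norm_num))

theorem killingNorm_eq {c : ℝ} (hc : 0 < c) (lam : ℝ) (x : Space) :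
    killingNorm c lam x = c * Real.cosh (curv lam * ‖x‖) := by
  have h : -(metric c lam (0, x) killing killing) = (c * Real.cosh (curv lam * ‖x‖)) ^ 2 := by
    simp [metric, killing, radial]
    ring
  rw [killingNorm, h, Real.sqrt_sq (mul_nonneg hc.le (Real.cosh_pos _).le)]

/-- The one-body weight `K₂(γ) / γ` is dominated by an integrable function. -/
theorem exists_integrable_oneBody_weight_le {c lam m β : ℝ} (hc : 0 < c) (hlam : lam < 0)
    (hm : 0 < m) (hβ : 0 < β) :
    ∃ h : Space → ℝ, Measurable h ∧ Integrable h ∧ (∀ x, 0 ≤ h x) ∧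
      ∀ x, Real.exp (-(β * oneBody c lam m β x)) ≤ h x := by
  set J : ℝ := ∫ t in Ioi (0 : ℝ), (1 + t ^ 2)⁻¹
  have hJ : 0 ≤ J := integral_nonneg fun t => by positivity
  set r₀ : ℝ := c * β * m * c
  have hr₀ : 0 < r₀ := by positivity
  have ha := curv_pos hlam
  -- Chosen so that `b (1 + ρ²) ≤ 1 + a²ρ² ≤ cosh² (aρ)`.
  set b : ℝ := min 1 (curv lam ^ 2)
  have hb : 0 < b := lt_min one_pos (by positivity)
  set D : ℝ := 48 * J / (r₀ ^ 5 * b ^ 2)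
  -- Decay of order `ρ⁻⁴` is integrable because `4 > 3`, the dimension.
  refine ⟨fun x => D * (1 + ‖x‖ ^ 2) ^ (-4 / 2 : ℝ), by fun_prop,
    (integrable_rpow_neg_one_add_norm_sq (by simp; norm_num)).const_mul D,
    fun x => by positivity, fun x => ?_⟩
  set C := Real.cosh (curv lam * ‖x‖)
  have hC1 : 1 ≤ C := Real.one_le_cosh _
  have hgam : gam c lam m β x = r₀ * C := by
    rw [gam, killingNorm_eq hc]; ring
  have hg : 0 < r₀ * C := by positivity
  have hw : Real.exp (-(β * oneBody c lam m β x)) = besselK 2 (r₀ * C) / (r₀ * C) := by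
    rw [oneBody, hgam]
    rw [show -(β * (-(1 / β) * Real.log (besselK 2 (r₀ * C) / (r₀ * C)))) =
      Real.log (besselK 2 (r₀ * C) / (r₀ * C)) by field_simp]
    exact Real.exp_log (div_pos (besselK_two_pos hg) hg)
  have hCb : b * (1 + ‖x‖ ^ 2) ≤ C ^ 2 := by
    refine le_trans ?_ (one_add_sq_le_cosh_sq _)
    have h1 : b ≤ 1 := min_le_left _ _
    have h2 : b * ‖x‖ ^ 2 ≤ curv lam ^ 2 * ‖x‖ ^ 2 := by
      gcongr; exact min_le_right _ _
    rw [mul_pow]; linarith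
  have hrpow : (1 + ‖x‖ ^ 2 : ℝ) ^ (-4 / 2 : ℝ) = ((1 + ‖x‖ ^ 2) ^ 2)⁻¹ := by
    rw [show (-4 / 2 : ℝ) = -((2 : ℕ) : ℝ) by norm_num, Real.rpow_neg (by positivity),
      Real.rpow_natCast]
  beta_reduce
  rw [hw, hrpow]
  -- Four of the five powers of `C` suffice; the last is dropped by `C ≥ 1`.
  calc besselK 2 (r₀ * C) / (r₀ * C) ≤ (48 / (r₀ * C) ^ 4 * J) / (r₀ * 1) := by
        gcongr
        exact besselK_two_le hg
    _ = 48 * J / r₀ ^ 5 * ((C ^ 2) ^ 2)⁻¹ := by field_simp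
    _ ≤ 48 * J / r₀ ^ 5 * ((b * (1 + ‖x‖ ^ 2)) ^ 2)⁻¹ := by gcongr
    _ = D * ((1 + ‖x‖ ^ 2) ^ 2)⁻¹ := by simp only [D]; field_simp

/-! ### Configurations -/

namespace Config

@[ext] theorem ext {x y : Config} (h : x.1 = y.1) : x = y := Subtype.ext h

/-- The empty configuration. -/
def empty : Config := ⟨∅, fun _ _ => by simp⟩

theorem ofTuple_zero (x : Fin 0 → Space) : ofTuple x = empty :=
  Config.ext (range_eq_empty x)

theorem measurable_count {Λ : Set Space} (hΛ : BorelRelCompact Λ) : Measurable (count Λ) := by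
  refine Measurable.of_comap_le ?_
  exact le_iSup₂_of_le (f := fun (Λ : Set Space) (_ : BorelRelCompact Λ) =>
    MeasurableSpace.comap (count Λ) ⊤) Λ hΛ le_rfl

theorem finite_inter {Λ : Set Space} (hΛ : BorelRelCompact Λ) (x : Config) :
    (x.1 ∩ Λ).Finite :=
  (x.2 _ hΛ.2).subset (inter_subset_inter_right _ subset_closure)

theorem measurableSet_disjoint {Λ : Set Space} (hΛ : BorelRelCompact Λ) :
    MeasurableSet {x : Config | x.1 ∩ Λ = ∅} := by
  have h : {x : Config | x.1 ∩ Λ = ∅} = count Λ ⁻¹' {0} := by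
    ext x
    simp only [mem_ofPred_eq, mem_preimage, mem_singleton_iff, count]
    -- `ncard` is also `0` on infinite sets, so local finiteness matters here.
    rw [Set.ncard_eq_zero (finite_inter hΛ x)]
  rw [h]
  exact measurable_count hΛ (measurableSet_singleton 0)

theorem glue_inter {Λ : Set Space} (x s : Config) : (glue Λ x s).1 ∩ Λ = x.1 ∩ Λ := by
  ext p
  simp only [glue, mem_inter_iff, mem_union, Set.mem_sdiff]
  tauto

end Config

/-- The ball of radius `k` about the observer. -/
abbrev window (k : ℕ) : Set Space := Metric.closedBall 0 k

theorem iUnion_window : ⋃ k, window k = univ := by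
  refine eq_univ_of_forall fun x => ?_
  obtain ⟨k, hk⟩ := exists_nat_ge ‖x‖
  exact mem_iUnion.2 ⟨k, by simpa using hk⟩

theorem window_mono {k l : ℕ} (h : k ≤ l) : window k ⊆ window l :=
  Metric.closedBall_subset_closedBall (by exact_mod_cast h)

theorem borelRelCompact_window_diff (k : ℕ) {T : Set Space} (hT : MeasurableSet T) :
    BorelRelCompact (window k \ T) :=
  ⟨measurableSet_closedBall.diff hT, (isCompact_closedBall (0 : Space) k).of_isClosed_subset
    isClosed_closure (closure_minimal sdiff_subset Metric.isClosed_closedBall)⟩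

theorem borelRelCompact_window (k : ℕ) : BorelRelCompact (window k) := by
  simpa using borelRelCompact_window_diff k MeasurableSet.empty

/-- The complement of `T` may be unbounded, whereas counting functions and the DLR equations only
concern relatively compact sets; exhaustion by windows bridges the two. -/
theorem compl_setOf_sdiff_eq_empty_eq_iUnion (T : Set Space) :
    {s : Config | s.1 \ T = ∅}ᶜ = ⋃ k, {s : Config | s.1 ∩ (window k \ T) = ∅}ᶜ := by
  ext s
  simp only [mem_compl_iff, mem_ofPred_eq, mem_iUnion, ← nonempty_iff_ne_empty, ← ne_eq]
  constructor
  · rintro ⟨p, hp, hpT⟩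
    obtain ⟨k, hk⟩ := mem_iUnion.1 (iUnion_window.symm ▸ mem_univ p)
    exact ⟨k, p, hp, hk, hpT⟩
  · rintro ⟨k, p, hp, -, hpT⟩
    exact ⟨p, hp, hpT⟩

theorem measurableSet_sdiff_eq_empty {T : Set Space} (hT : MeasurableSet T) :
    MeasurableSet {s : Config | s.1 \ T = ∅} := by
  rw [← MeasurableSet.compl_iff, compl_setOf_sdiff_eq_empty_eq_iUnion]
  exact MeasurableSet.iUnion fun k =>
    (Config.measurableSet_disjoint (borelRelCompact_window_diff k hT)).compl

theorem measurableSet_singleton_empty : MeasurableSet ({Config.empty} : Set Config) := by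
  convert measurableSet_sdiff_eq_empty MeasurableSet.empty using 1
  ext s
  simp only [mem_singleton_iff, sdiff_empty, mem_ofPred_eq]
  exact ⟨fun h => by rw [h]; rfl, fun h => Config.ext h⟩

/-! ### The Poisson measure -/

theorem lintegral_pi_prod_eq_pow {α : Type*} [MeasurableSpace α] (μ : Measure α) [SigmaFinite μ]
    {f : α → ℝ≥0∞} (hf : Measurable f) (n : ℕ) :
    ∫⁻ x, ∏ i, f (x i) ∂Measure.pi (fun _ : Fin n => μ) = (∫⁻ a, f a ∂μ) ^ n := by
  induction n with
  | zero => simp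
  | succ n ih =>
    rw [← ((measurePreserving_piFinSuccAbove (fun _ : Fin (n + 1) => μ) 0).symm).lintegral_comp_emb
      (MeasurableEquiv.measurableEmbedding _)]
    simp only [MeasurableEquiv.piFinSuccAbove_symm_apply, Fin.prod_univ_succ, Fin.insertNthEquiv,
      Fin.zero_succAbove, Equiv.coe_fn_mk, Fin.insertNth_zero', Fin.cons_zero, Fin.cons_succ]
    rw [lintegral_prod_mul (g := fun y : Fin n → α => ∏ i, f (y i)) hf.aemeasurable
      (Finset.measurable_fun_prod _ fun i _ => hf.comp (measurable_pi_apply i)).aemeasurable,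
      ih, pow_succ']

/-- A product bound integrates to an `n`-th power by Fubini once distinctness of the points is
forgotten. `F` may be non-measurable: for an upper bound, `lintegral_map_le` suffices. -/
theorem lintegral_poisson_le {z : ℝ} {Λ : Set Space}
    (F : Config → ℝ≥0∞) (a : ℕ → ℝ≥0∞) {f : Space → ℝ≥0∞} (hf : Measurable f)
    (hF : ∀ (n : ℕ) (x : Fin n → Space), (∀ i, x i ∈ Λ) → Function.Injective x →
      F (Config.ofTuple x) ≤ a n * ∏ i, f (x i)) :
    ∫⁻ x, F x ∂poisson z Λ ≤
      ∑' n : ℕ, ENNReal.ofReal (z ^ n / n.factorial) * (a n * (∫⁻ p in Λ, f p) ^ n) := by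
  rw [poisson, lintegral_sum_measure]
  refine ENNReal.tsum_le_tsum fun n => ?_
  rw [lintegral_smul_measure, smul_eq_mul]
  gcongr
  refine (lintegral_map_le _ _).trans ?_
  have hpi : Measurable fun x : Fin n → Space => ∏ i, f (x i) :=
    Finset.measurable_fun_prod _ fun i _ => hf.comp (measurable_pi_apply i)
  calc _ ≤ ∫⁻ x in {x : Fin n → Space | (∀ i, x i ∈ Λ) ∧ Function.Injective x},
        a n * ∏ i, f (x i) := by
        refine setLIntegral_mono (hpi.const_mul _) fun x hx => hF n x hx.1 hx.2
    _ ≤ ∫⁻ x in univ.pi fun _ : Fin n => Λ, a n * ∏ i, f (x i) :=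
        lintegral_mono_set fun x hx i _ => hx.1 i
    _ = _ := by
        rw [lintegral_const_mul _ hpi, volume_pi, Measure.restrict_pi_pi,
          lintegral_pi_prod_eq_pow _ hf]

/-- The term `n = 0` of the Poisson measure is the Dirac mass at the empty configuration. Since `F`
is arbitrary, it is replaced by a measurable minorant supported there. -/
theorem apply_empty_le_lintegral_poisson (z : ℝ) (Λ : Set Space) (F : Config → ℝ≥0∞) :
    F Config.empty ≤ ∫⁻ x, F x ∂poisson z Λ := by
  have h1 : Measure.dirac Config.empty ≤ poisson z Λ := by
    rw [poisson]
    refine le_trans (le_of_eq ?_) (Measure.le_sum _ 0)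
    have hu : {x : Fin 0 → Space | (∀ i, x i ∈ Λ) ∧ Function.Injective x} = univ :=
      eq_univ_of_forall fun x => ⟨fun i => i.elim0, fun i => i.elim0⟩
    rw [hu, Measure.restrict_univ, volume_pi, Measure.pi_of_empty _ Fin.elim0,
      Measure.map_dirac' (Config.measurable_ofTuple 0), Config.ofTuple_zero]
    simp
  refine le_trans ?_ (lintegral_mono' h1 le_rfl)
  have h2 : ∀ x, ({Config.empty} : Set Config).indicator (fun _ => F Config.empty) x ≤ F x :=
    fun x => indicator_apply_le fun hx => by rw [mem_singleton_iff.1 hx]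
  refine le_trans (le_of_eq ?_) (lintegral_mono h2)
  rw [lintegral_indicator_const measurableSet_singleton_empty]
  simp

/-! ### Energy bounds -/

theorem sumOrTop_of_ne_top {I : Set (Finset Space)} {f : Finset Space → EReal}
    (h : sumOrTop I f ≠ ⊤) : (∀ y ∈ I, f y ≠ ⊤) ∧ Summable fun y : I => (f y).toReal := by
  by_contra hc
  exact h (if_neg hc)

theorem sumOrTop_eq {I : Set (Finset Space)} {f : Finset Space → EReal}
    (h : (∀ y ∈ I, f y ≠ ⊤) ∧ Summable fun y : I => (f y).toReal) :
    sumOrTop I f = ((∑' y : I, (f y).toReal : ℝ) : EReal) := if_pos h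

theorem clusters_empty (Λ s : Set Space) : clusters Λ ∅ s = ∅ := by
  ext y; simp [clusters]

theorem singletons_subset_clusters (Λ s : Set Space) (x : Finset Space) :
    ((fun p : Space => ({p} : Finset Space)) '' (x : Set Space)) ⊆ clusters Λ x s := by
  rintro _ ⟨p, hp, rfl⟩
  exact ⟨by simpa using Or.inl hp, p, by simp, hp⟩

theorem clusters_eq_union (Λ s : Set Space) (x : Finset Space) :
    clusters Λ x s = ((fun p : Space => ({p} : Finset Space)) '' (x : Set Space)) ∪
      {y ∈ clusters Λ x s | 2 ≤ y.card} := by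
  refine Subset.antisymm (fun y hy => ?_)
    (union_subset (singletons_subset_clusters Λ s x) fun y hy => hy.1)
  obtain ⟨p, hpy, hpx⟩ := hy.2
  rcases lt_or_ge y.card 2 with h | h
  · left
    have h1 : y.card = 1 := by
      have := Finset.card_pos.2 ⟨p, hpy⟩
      omega
    obtain ⟨q, rfl⟩ := Finset.card_eq_one.1 h1
    have : p = q := by simpa using hpy
    exact ⟨p, hpx, by rw [this]⟩
  · exact Or.inr ⟨hy, h⟩

namespace ManyBodyPotential

variable (Φ : ManyBodyPotential) (c G lam m β : ℝ)

/-- If the full sum is `+∞` there is nothing to prove. Otherwise absolute convergence passes to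
subfamilies, and the sum splits into its one-body part and the many-body energy, to which stability
applies. -/
theorem le_sumOrTop_full {B : ℝ} {Λ s : Set Space} {x : Finset Space}
    (hB : ((-(B * x.card) : ℝ) : EReal) < Φ.manyBodyEnergy Λ x s) :
    ((∑ p ∈ x, oneBody c lam m β p - B * x.card : ℝ) : EReal) ≤
      sumOrTop (clusters Λ x s) (Φ.full c lam m β) := by
  by_cases htop : sumOrTop (clusters Λ x s) (Φ.full c lam m β) = ⊤
  · rw [htop]; exact le_top
  obtain ⟨hne, hsum⟩ := sumOrTop_of_ne_top htop
  rw [sumOrTop_eq ⟨hne, hsum⟩, EReal.coe_le_coe_iff]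
  set F : Finset Space → ℝ := fun y => (Φ.full c lam m β y).toReal
  set S : Set (Finset Space) := (fun p : Space => ({p} : Finset Space)) '' (x : Set Space)
  set M : Set (Finset Space) := {y ∈ clusters Λ x s | 2 ≤ y.card}
  have hfull : ∀ y ∈ M, Φ.full c lam m β y = Φ.φ y := fun y hy =>
    if_neg (by have := hy.2; omega)
  have hinj : InjOn (fun p : Space => ({p} : Finset Space)) (x : Set Space) :=
    Finset.singleton_injective.injOn
  have hSM : Disjoint S M := by
    rw [disjoint_left]
    rintro _ ⟨p, -, rfl⟩ h
    simpa using h.2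
  have hMsub : M ⊆ clusters Λ x s := fun y hy => hy.1
  have hSsub : S ⊆ clusters Λ x s := singletons_subset_clusters Λ s x
  have hsumF : Summable (F ∘ ((↑) : clusters Λ x s → Finset Space)) := hsum
  have hsumM : Summable (F ∘ ((↑) : M → Finset Space)) := by
    rw [summable_subtype_iff_indicator] at hsumF ⊢
    rw [← inter_eq_self_of_subset_left hMsub, ← indicator_indicator]
    exact hsumF.indicator M
  have hsumS : Summable (F ∘ ((↑) : S → Finset Space)) := by
    rw [summable_subtype_iff_indicator] at hsumF ⊢
    rw [← inter_eq_self_of_subset_left hSsub, ← indicator_indicator]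
    exact hsumF.indicator S
  have hM : Φ.manyBodyEnergy Λ x s = ((∑' y : M, F y : ℝ) : EReal) := by
    have he : ∀ y : M, F y = (Φ.φ y).toReal := fun y => by simp only [F]; rw [hfull y y.2]
    simp only [he]
    refine sumOrTop_eq ⟨fun y hy => ?_, ?_⟩
    · rw [← hfull y hy]; exact hne y hy.1
    · refine hsumM.congr fun y => he y
  have hS : ∑' y : S, F y = ∑ p ∈ x, oneBody c lam m β p := by
    rw [tsum_image F hinj, ← Finset.tsum_subtype x (oneBody c lam m β)]
    refine tsum_congr fun p => ?_
    simp [F, full]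
  rw [hM, EReal.coe_lt_coe_iff] at hB
  have htotal : ∑' y : clusters Λ x s, F y = ∑' y : S, F y + ∑' y : M, F y := by
    rw [clusters_eq_union Λ s x]
    exact hsumS.tsum_union_disjoint hSM hsumM
  change _ ≤ ∑' y : clusters Λ x s, F y
  rw [htotal, hS]
  linarith

/-- The Boltzmann factor of the vacuum energy. -/
noncomputable def vacuumWeight (Λ : Set Space) : ℝ :=
  Real.exp (-(β * ((properVolume c lam Λ).toReal * vacuumDensity c G lam)))

theorem boltzmann_empty (Λ : Set Space) (s : Config) :
    Φ.boltzmann c G lam m β Λ Config.empty s =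
      ENNReal.ofReal (vacuumWeight c G lam β Λ) := by
  have h : sumOrTop (clusters Λ Config.empty.1 s.1) (Φ.full c lam m β) = ((0 : ℝ) : EReal) := by
    have he : clusters Λ Config.empty.1 s.1 = ∅ := clusters_empty Λ s.1
    rw [he, sumOrTop_eq ⟨fun y hy => absurd hy (notMem_empty y), summable_empty⟩]
    simp
  rw [boltzmann, energy, h, ← EReal.coe_add, ← EReal.coe_mul, ← EReal.coe_neg, EReal.exp_coe,
    add_zero, vacuumWeight]

variable {β} in
theorem boltzmann_ofTuple_le (hβ : 0 < β) {B : ℝ} {Λ : Set Space} {s : Config}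
    (hB : ∀ x : Finset Space, (x : Set Space) ⊆ Λ → x.Nonempty →
      ((-(B * x.card) : ℝ) : EReal) < Φ.manyBodyEnergy Λ x s.1)
    {h : Space → ℝ} (hh : ∀ x, Real.exp (-(β * oneBody c lam m β x)) ≤ h x)
    {n : ℕ} {x : Fin n → Space} (hx : ∀ i, x i ∈ Λ) (hinj : Function.Injective x) :
    Φ.boltzmann c G lam m β Λ (Config.ofTuple x) s ≤
      ENNReal.ofReal (vacuumWeight c G lam β Λ) * ENNReal.ofReal (Real.exp (β * B)) ^ n *
        ∏ i, ENNReal.ofReal (h (x i)) := by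
  -- The strict stability bound is available only for nonempty configurations.
  rcases Nat.eq_zero_or_pos n with rfl | hn
  · rw [Config.ofTuple_zero, boltzmann_empty]
    simp
  set X : Finset Space := Finset.univ.map ⟨x, hinj⟩
  have hX : (X : Set Space) = range x := by simp [X]
  have hcard : X.card = n := by simp [X]
  have hlow := Φ.le_sumOrTop_full c lam m β (hB X (by rw [hX]; rintro _ ⟨i, rfl⟩; exact hx i)
    (Finset.card_pos.1 (by omega)))
  have hsumX : ∑ p ∈ X, oneBody c lam m β p = ∑ i, oneBody c lam m β (x i) := by simp [X]
  rw [hcard, hsumX, hX] at hlow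
  set v : ℝ := (properVolume c lam Λ).toReal * vacuumDensity c G lam
  set u : ℝ := ∑ i, oneBody c lam m β (x i) - B * n
  have hen : ((v + u : ℝ) : EReal) ≤ Φ.energy c G lam m β Λ (Config.ofTuple x).1 s.1 := by
    rw [EReal.coe_add]
    exact add_le_add le_rfl hlow
  have h1 : Φ.boltzmann c G lam m β Λ (Config.ofTuple x) s ≤
      ENNReal.ofReal (Real.exp (-(β * (v + u)))) := by
    rw [← EReal.exp_coe, boltzmann, EReal.exp_le_exp_iff, EReal.coe_neg, EReal.neg_le_neg_iff,
      EReal.coe_mul]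
    exact mul_le_mul_of_nonneg_left hen (by exact_mod_cast hβ.le)
  refine h1.trans (le_of_eq_of_le (b := ENNReal.ofReal (vacuumWeight c G lam β Λ) *
    ENNReal.ofReal (Real.exp (β * B)) ^ n *
      ∏ i, ENNReal.ofReal (Real.exp (-(β * oneBody c lam m β (x i))))) ?_ ?_)
  · rw [← ENNReal.ofReal_prod_of_nonneg fun i _ => (Real.exp_pos _).le,
      ← ENNReal.ofReal_pow (Real.exp_pos _).le, vacuumWeight,
      ← ENNReal.ofReal_mul (Real.exp_pos _).le, ← ENNReal.ofReal_mul (by positivity),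
      ← Real.exp_nat_mul, ← Real.exp_sum, ← Real.exp_add, ← Real.exp_add]
    congr 2
    simp only [u, Finset.sum_neg_distrib, ← Finset.mul_sum]
    ring
  · gcongr with i
    exact hh (x i)

end ManyBodyPotential

/-! ### The local specification -/

theorem tsum_ofReal_pow_div_factorial {κ : ℝ} (hκ : 0 ≤ κ) :
    ∑' n : ℕ, ENNReal.ofReal (κ ^ n / n.factorial) = ENNReal.ofReal (Real.exp κ) := by
  have h := NormedSpace.expSeries_div_hasSum_exp κ
  rw [← Real.exp_eq_exp_ℝ] at h
  rw [← ENNReal.ofReal_tsum_of_nonneg (fun n => by positivity) h.summable, h.tsum_eq]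

theorem tsum_ofReal_pow_div_factorial_succ {κ : ℝ} (hκ : 0 ≤ κ) :
    ∑' n : ℕ, ENNReal.ofReal (κ ^ (n + 1) / (n + 1).factorial) =
      ENNReal.ofReal (Real.exp κ - 1) := by
  have h := tsum_ofReal_pow_div_factorial hκ
  rw [tsum_eq_zero_add' ENNReal.summable] at h
  rw [ENNReal.ofReal_sub _ zero_le_one, ← h]
  simp

namespace ManyBodyPotential

variable {Φ : ManyBodyPotential} {c G lam m β z B : ℝ} {Λ : Set Space} {h : Space → ℝ}
  {s : Config}

theorem vacuumWeight_pos (c G lam β : ℝ) (Λ : Set Space) :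
    0 < ENNReal.ofReal (vacuumWeight c G lam β Λ) :=
  ENNReal.ofReal_pos.2 (Real.exp_pos _)

theorem vacuumWeight_le_partition (Φ : ManyBodyPotential) (c G lam m β z : ℝ) (Λ : Set Space)
    (s : Config) :
    ENNReal.ofReal (vacuumWeight c G lam β Λ) ≤ Φ.partition c G lam m β z Λ s := by
  rw [← Φ.boltzmann_empty c G lam m β Λ s]
  exact apply_empty_le_lintegral_poisson z Λ fun x => Φ.boltzmann c G lam m β Λ x s

/-- A many-body potential, seen from the volume `Λ`, whose energy is bounded below by `-B` per
particle, together with an integrable bound `h` of its one-body weight. -/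
structure IsDominated (Φ : ManyBodyPotential) (c lam m β B : ℝ) (h : Space → ℝ) (Λ : Set Space)
    (s : Config) : Prop where
  stable : ∀ x : Finset Space, (x : Set Space) ⊆ Λ → x.Nonempty →
    ((-(B * x.card) : ℝ) : EReal) < Φ.manyBodyEnergy Λ x s.1
  measurable : Measurable h
  integrable : Integrable h
  nonneg : ∀ x, 0 ≤ h x
  oneBody_le : ∀ x, Real.exp (-(β * oneBody c lam m β x)) ≤ h x

/-- The effective activity of `T`. -/
noncomputable def activity (β z B : ℝ) (h : Space → ℝ) (T : Set Space) : ℝ :=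
  z * Real.exp (β * B) * ∫ x in T, h x

theorem activity_nonneg (hz : 0 ≤ z) (h0 : ∀ x, 0 ≤ h x) (T : Set Space) :
    0 ≤ activity β z B h T :=
  mul_nonneg (mul_nonneg hz (Real.exp_pos _).le) (integral_nonneg h0)

theorem activity_mono (hz : 0 ≤ z) (hi : Integrable h) (h0 : ∀ x, 0 ≤ h x) {S T : Set Space}
    (hST : S ⊆ T) : activity β z B h S ≤ activity β z B h T :=
  mul_le_mul_of_nonneg_left (setIntegral_mono_set hi.integrableOn (Eventually.of_forall h0)
    (Eventually.of_forall hST)) (mul_nonneg hz (Real.exp_pos _).le)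

/-- Puts the `n`-particle bound in the form of a term of the exponential series of the activity. -/
theorem IsDominated.weight_eq (H : Φ.IsDominated c lam m β B h Λ s) (hz : 0 ≤ z) (n : ℕ)
    (v : ℝ≥0∞) :
    ENNReal.ofReal (z ^ n / n.factorial) * (v * ENNReal.ofReal (Real.exp (β * B)) ^ n *
      (∫⁻ p in Λ, ENNReal.ofReal (h p)) ^ n) =
      v * ENNReal.ofReal (activity β z B h Λ ^ n / n.factorial) := by
  rw [← ofReal_integral_eq_lintegral_ofReal H.integrable.integrableOn
    (Eventually.of_forall H.nonneg), mul_assoc v, ← ENNReal.ofReal_pow (Real.exp_pos _).le,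
    ← ENNReal.ofReal_pow (integral_nonneg H.nonneg), ← ENNReal.ofReal_mul (by positivity),
    mul_left_comm, ← ENNReal.ofReal_mul (by positivity), activity]
  congr 2
  ring

theorem IsDominated.partition_lt_top (H : Φ.IsDominated c lam m β B h Λ s) (hβ : 0 < β)
    (hz : 0 ≤ z) : Φ.partition c G lam m β z Λ s < ⊤ := by
  refine (lintegral_poisson_le _ _ H.measurable.ennreal_ofReal fun n x hx hinj =>
    Φ.boltzmann_ofTuple_le c G lam m hβ H.stable H.oneBody_le hx hinj).trans_lt ?_
  simp_rw [H.weight_eq hz]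
  rw [ENNReal.tsum_mul_left, tsum_ofReal_pow_div_factorial (activity_nonneg hz H.nonneg Λ)]
  exact ENNReal.mul_lt_top ENNReal.ofReal_lt_top ENNReal.ofReal_lt_top

theorem specification_le_one (A : Set Config) :
    Φ.specification c G lam m β z Λ A s ≤ 1 := by
  rw [specification]
  split_ifs with hZ
  · calc _ ≤ (Φ.partition c G lam m β z Λ s)⁻¹ * Φ.partition c G lam m β z Λ s := by
          refine mul_le_mul_right (lintegral_mono fun x => ?_) _
          refine mul_le_of_le_one_left' (indicator_apply_le' (fun _ => le_rfl) fun _ => zero_le)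
      _ ≤ 1 := ENNReal.inv_mul_le_one _
  · exact zero_le

/-- The probability that `Λ` is not empty is bounded in terms of its activity. -/
theorem IsDominated.specification_occupied_le (H : Φ.IsDominated c lam m β B h Λ s) (hβ : 0 < β)
    (hz : 0 ≤ z) :
    Φ.specification c G lam m β z Λ {x : Config | x.1 ∩ Λ = ∅}ᶜ s ≤
      ENNReal.ofReal (Real.exp (activity β z B h Λ) - 1) := by
  rw [specification, if_pos (H.partition_lt_top hβ hz)]
  set A : Set Config := {x : Config | x.1 ∩ Λ = ∅}ᶜ
  set v := ENNReal.ofReal (vacuumWeight c G lam β Λ)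
  have hnum : ∫⁻ x, A.indicator 1 (Config.glue Λ x s) * Φ.boltzmann c G lam m β Λ x s
      ∂poisson z Λ ≤ v * ENNReal.ofReal (Real.exp (activity β z B h Λ) - 1) := by
    -- The empty configuration leaves `Λ` unoccupied, so the series starts at `n = 1`; this is the
    -- source of the `-1`.
    refine (lintegral_poisson_le _ (fun n => if n = 0 then 0 else
      v * ENNReal.ofReal (Real.exp (β * B)) ^ n) H.measurable.ennreal_ofReal
      fun n x hx hinj => ?_).trans (le_of_eq ?_)
    · rcases Nat.eq_zero_or_pos n with rfl | hn
      · have hA : Config.glue Λ (Config.ofTuple x) s ∉ A := by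
          have := Config.glue_inter (Λ := Λ) (Config.ofTuple x) s
          rw [Config.ofTuple_zero, Config.empty, empty_inter] at this
          simpa [A, Config.ofTuple_zero, Config.empty] using this
        simp [hA]
      · rw [if_neg hn.ne']
        refine le_trans (mul_le_of_le_one_left' (indicator_apply_le' (fun _ => le_rfl)
          fun _ => zero_le)) ?_
        exact Φ.boltzmann_ofTuple_le c G lam m hβ H.stable H.oneBody_le hx hinj
    · rw [tsum_eq_zero_add' ENNReal.summable]
      simp only [Nat.add_eq_zero_iff, one_ne_zero, and_false, if_false, if_true, zero_mul,
        mul_zero, zero_add]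
      simp_rw [H.weight_eq hz]
      rw [ENNReal.tsum_mul_left,
        tsum_ofReal_pow_div_factorial_succ (activity_nonneg hz H.nonneg Λ)]
  calc _ ≤ v⁻¹ * (v * ENNReal.ofReal (Real.exp (activity β z B h Λ) - 1)) :=
        mul_le_mul' (ENNReal.inv_le_inv.2 (vacuumWeight_le_partition Φ c G lam m β z Λ s)) hnum
    _ = _ := by
        rw [← mul_assoc, ENNReal.inv_mul_cancel (vacuumWeight_pos c G lam β Λ).ne'
          ENNReal.ofReal_ne_top, one_mul]

/-- The specification depends on the boundary condition only outside of `Λ`. -/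
theorem specification_congr (Φ : ManyBodyPotential) (c G lam m β z : ℝ) (A : Set Config)
    {s t : Config} (hst : s.1 \ Λ = t.1 \ Λ) :
    Φ.specification c G lam m β z Λ A s = Φ.specification c G lam m β z Λ A t := by
  have hb : ∀ x, Φ.boltzmann c G lam m β Λ x s = Φ.boltzmann c G lam m β Λ x t := fun x => by
    simp only [boltzmann, energy, clusters, hst]
  have hg : ∀ x, Config.glue Λ x s = Config.glue Λ x t := fun x =>
    Config.ext (by simp only [Config.glue, hst])
  simp only [specification, partition, hb, hg]
  congr

/-! ### Gibbs states -/

variable {μ : Measure Config}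

theorem IsGibbsState.measure_occupied_le (hμ : Φ.IsGibbsState c G lam m β z μ)
    (hΛ : BorelRelCompact Λ) (H : ∀ s, Φ.IsDominated c lam m β B h Λ s) (hβ : 0 < β)
    (hz : 0 ≤ z) :
    μ {x : Config | x.1 ∩ Λ = ∅}ᶜ ≤ ENNReal.ofReal (Real.exp (activity β z B h Λ) - 1) := by
  have := hμ.prob
  rw [← hμ.dlr Λ hΛ _ (Config.measurableSet_disjoint hΛ).compl]
  refine (lintegral_mono fun s => (H s).specification_occupied_le hβ hz).trans ?_
  simp

/-- The probability that there are particles outside of `T`. -/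
theorem IsGibbsState.measure_sdiff_nonempty_le (hμ : Φ.IsGibbsState c G lam m β z μ)
    {T : Set Space} (hT : MeasurableSet T)
    (H : ∀ Λ, BorelRelCompact Λ → ∀ s, Φ.IsDominated c lam m β B h Λ s) (hβ : 0 < β)
    (hz : 0 ≤ z) :
    μ {s : Config | s.1 \ T = ∅}ᶜ ≤ ENNReal.ofReal (Real.exp (activity β z B h Tᶜ) - 1) := by
  have H0 := H (window 0) (borelRelCompact_window 0) Config.empty
  -- Continuity from below: a bound uniform in the window passes to the union.
  rw [compl_setOf_sdiff_eq_empty_eq_iUnion, Monotone.measure_iUnion]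
  · refine iSup_le fun k => ?_
    have hk := borelRelCompact_window_diff k hT
    refine (hμ.measure_occupied_le hk (H _ hk) hβ hz).trans (ENNReal.ofReal_le_ofReal ?_)
    have := activity_mono (β := β) (B := B) hz H0.integrable H0.nonneg
      (show window k \ T ⊆ Tᶜ from fun x hx => hx.2)
    gcongr
  · intro k l hkl s hs hsl
    refine hs (subset_empty_iff.1 fun p hp => ?_)
    rw [← (show s.1 ∩ (window l \ T) = ∅ from hsl)]
    exact ⟨hp.1, window_mono hkl hp.2.1, hp.2.2⟩

/-- Split the DLR integral according to whether there are particles outside `Λ`. Without them the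
integrand is the constant `Π_Λ(A, ∅)`; with them it lies between `0` and `1`. -/
theorem IsGibbsState.le_specification_empty_add (hμ : Φ.IsGibbsState c G lam m β z μ)
    (hΛ : BorelRelCompact Λ) {A : Set Config} (hA : MeasurableSet A) :
    μ A ≤ Φ.specification c G lam m β z Λ A Config.empty +
        μ {s : Config | s.1 \ Λ = ∅}ᶜ ∧
      Φ.specification c G lam m β z Λ A Config.empty ≤
        μ A + μ {s : Config | s.1 \ Λ = ∅}ᶜ := by
  have := hμ.prob
  set E : Set Config := {s : Config | s.1 \ Λ = ∅}
  have hE : MeasurableSet E := measurableSet_sdiff_eq_empty hΛ.1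
  set q := Φ.specification c G lam m β z Λ A Config.empty
  have hq : q ≤ 1 := specification_le_one A
  have h1 : ∫⁻ s in E, Φ.specification c G lam m β z Λ A s ∂μ = q * μ E := by
    rw [setLIntegral_congr_fun (g := fun _ => q) hE fun s hs => ?_]
    · simp
    · exact specification_congr Φ c G lam m β z A
        ((show s.1 \ Λ = ∅ from hs).trans (empty_sdiff (s := Λ)).symm)
  have h2 : ∫⁻ s in Eᶜ, Φ.specification c G lam m β z Λ A s ∂μ ≤ μ Eᶜ :=
    (lintegral_mono fun s => specification_le_one A).trans (by simp)
  -- Only the event `E` has to be measurable here, not the specification as a function of `s`.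
  have h3 := lintegral_add_compl (μ := μ) (fun s => Φ.specification c G lam m β z Λ A s) hE
  rw [hμ.dlr Λ hΛ A hA, h1] at h3
  refine ⟨?_, ?_⟩
  · rw [← h3]
    exact add_le_add (mul_le_of_le_one_right' prob_le_one) h2
  · calc q = q * μ E + q * μ Eᶜ := by
          rw [← mul_add, measure_add_measure_compl hE, measure_univ, mul_one]
      _ ≤ μ A + μ Eᶜ := add_le_add (le_self_add.trans h3.le) (mul_le_of_le_one_left' hq)

theorem tendsto_activity_compl_window (β z B : ℝ) (hi : Integrable h) :
    Tendsto (fun k => ENNReal.ofReal (Real.exp (activity β z B h (window k)ᶜ) - 1)) atTop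
      (𝓝 0) := by
  have h1 : Tendsto (fun k => ∫ x in (window k)ᶜ, h x) atTop (𝓝 0) := by
    have := tendsto_setIntegral_of_antitone (μ := volume) (f := h)
      (s := fun k => (window k)ᶜ) (fun k => measurableSet_closedBall.compl)
      (fun k l hkl => compl_subset_compl.2 (window_mono hkl)) ⟨0, hi.integrableOn⟩
    rwa [← compl_iUnion, iUnion_window, compl_univ, setIntegral_empty] at this
  have h2 := (Real.continuous_exp.tendsto _).comp (h1.const_mul (z * Real.exp (β * B)))
  have h3 := ENNReal.tendsto_ofReal (h2.sub_const 1)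
  simpa [activity] using h3

theorem IsGibbsState.eq_of_isDominated {μ₁ μ₂ : Measure Config}
    (hμ₁ : Φ.IsGibbsState c G lam m β z μ₁) (hμ₂ : Φ.IsGibbsState c G lam m β z μ₂)
    (H : ∀ Λ, BorelRelCompact Λ → ∀ s, Φ.IsDominated c lam m β B h Λ s) (hβ : 0 < β)
    (hz : 0 ≤ z) : μ₁ = μ₂ := by
  have H0 := H (window 0) (borelRelCompact_window 0) Config.empty
  have key : ∀ {μ ν : Measure Config}, Φ.IsGibbsState c G lam m β z μ →
      Φ.IsGibbsState c G lam m β z ν → ∀ A, MeasurableSet A → μ A ≤ ν A := by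
    intro μ ν hμ hν A hA
    have ht := tendsto_activity_compl_window β z B H0.integrable
    -- One error for passing from `μ` to `Π_Λ(·, ∅)`, another for passing on to `ν`.
    have ht2 := (tendsto_const_nhds (x := ν A)).add (ht.add ht)
    rw [add_zero, add_zero] at ht2
    refine ge_of_tendsto' ht2 fun k => ?_
    have hk := borelRelCompact_window k
    refine (hμ.le_specification_empty_add hk hA).1.trans ?_
    rw [← add_assoc]
    exact add_le_add ((hν.le_specification_empty_add hk hA).2.trans
      (add_le_add le_rfl (hν.measure_sdiff_nonempty_le hk.1 H hβ hz)))
      (hμ.measure_sdiff_nonempty_le hk.1 H hβ hz)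
  exact Measure.ext fun A hA => le_antisymm (key hμ₁ hμ₂ A hA) (key hμ₂ hμ₁ A hA)

end ManyBodyPotential

end AdS

theorem mainTheorem3
    (c G lam m : ℝ) (hc : 0 < c) (hG : 0 < G) (hlam : lam < 0) (hm : 0 < m)
    (Φ : AdS.ManyBodyPotential) (hrange : Φ.HasFiniteRange c lam) (hstable : Φ.IsStable) :
    ∀ β z : ℝ, 0 < β → 0 ≤ z → ∀ μ₁ μ₂ : MeasureTheory.Measure AdS.Config,
      Φ.IsGibbsState c G lam m β z μ₁ → Φ.IsGibbsState c G lam m β z μ₂ → μ₁ = μ₂ := by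
  intro β z hβ hz μ₁ μ₂ hμ₁ hμ₂
  obtain ⟨B, -, hB⟩ := hstable
  obtain ⟨h, hmeas, hint, h0, hle⟩ := AdS.exists_integrable_oneBody_weight_le hc hlam hm hβ
  exact hμ₁.eq_of_isDominated hμ₂ (fun Λ hΛ s => ⟨hB Λ hΛ s, hmeas, hint, h0, hle⟩) hβ hz
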